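/- Let $A=(a_{ij})_{i,j=1}^n$ be a symmetrizable generalized Cartan matrix, that is, an integer matrix with $a_{ii}=2$, $a_{ij}\le 0$ for $i\neq j$, and $a_{ij}=0\Leftrightarrow a_{ji}=0$, which is the product of an invertible diagonal matrix and a symmetric matrix. Let $(\mathfrak h,\{\alpha_i\}_{i=1}^n,\{h_i\}_{i=1}^n)$ be a realization of $A$: $\mathfrak h$ is a complex vector space of dimension $2n-\mathrm{rk}(A)$, and $\alpha_i\in\mathfrak h^*$, $h_i\in\mathfrak h$ ($1\le i\le n$) are two linearly independent families with $\alpha_j(h_i)=a_{ij}$. Let $\mathfrak g(A)$ be the Kac–Moody algebra, i.e. the complex Lie algebra generated by the vector space $\mathfrak h$ and elements $e_i,f_i$ ($1\le i\le n$) with defining relations $$[h,h']=0,\quad [h,e_j]=\alpha_j(h)e_j,\quad [h,f_j]=-\alpha_j(h)f_j,\quad [e_i,f_j]=\delta_{ij}h_i\qquad(h,h'\in\mathfrak h,\ 1\le i,j\le n),$$ $$(\mathrm{ad}\,e_i)^{1-a_{ij}}e_j=0=(\mathrm{ad}\,f_i)^{1-a_{ij}}f_j\qquad(i\neq j).$$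 Let $\omega$ be its Chevalley involution, the involutive automorphism with $\omega(h)=-h$ for $h\in\mathfrak h$, $\omega(e_i)=-f_i$ and $\omega(f_i)=-e_i$, and let $\mathfrak k(A)=\{x\in\mathfrak g(A)\mid\omega(x)=x\}$. Put $Y_i=e_i-f_i\in\mathfrak k(A)$ and $$\mathcal E_A=\{j\in\{1,\dots,n\}\mid a_{ij}\equiv 0 \ (\mathrm{mod}\ 2)\ \text{for all } i\in\{1,\dots,n\}\}.$$ Let $\mathrm{ch}(\mathfrak k(A))$ be the complex vector space, under pointwise operations, of one-dimensional representations of $\mathfrak k(A)$, i.e. of Lie algebra homomorphisms $\mathfrak k(A)\to\mathbb C$. Then for every $\mathbf t=(t_j)_{j\in\mathcal E_A}\in\mathbb C^{\mathcal E_A}$ there is a unique $\chi_{\mathbf t}\in\mathrm{ch}(\mathfrak k(A))$ such that, for $1\le j\le n$, $$\chi_{\mathbf t}(Y_j)=\begin{cases}t_j&\text{if } j\in\mathcal E_A,\\ 0&\text{if } j\notin\mathcal E_A,\end{cases}$$ and the map $\mathbb C^{\mathcal E_A}\to\mathrm{ch}(\mathfrak k(A))$, $\mathbf t\mapsto\chi_{\mathbf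 t}$, is a linear isomorphism. -/

import Mathlib

noncomputable section

namespace KacMoody

universe u

variable {n : ℕ}

/-- `A` is a generalized Cartan matrix: integral, with diagonal entries `2`, nonpositive
off-diagonal entries, and `a_ij = 0` if and only if `a_ji = 0`. -/
structure IsGCM (A : Matrix (Fin n) (Fin n) ℤ) : Prop where
  diag : ∀ i, A i i = 2
  nonpos : ∀ i j, i ≠ j → A i j ≤ 0
  zero_iff : ∀ i j, A i j = 0 ↔ A j i = 0

/-- `A` is symmetrizable: `A = D * S` with `D` an invertible diagonal matrix and `S` a symmetric
matrix. -/
def IsSymmetrizable (A : Matrix (Fin n) (Fin n) ℤ) : Prop :=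
  ∃ (d : Fin n → ℂ) (S : Matrix (Fin n) (Fin n) ℂ),
    (∀ i, d i ≠ 0) ∧ S.IsSymm ∧ A.map (Int.cast : ℤ → ℂ) = Matrix.diagonal d * S

/-- A realization of `A` on the complex vector space `𝔥`: the dimension of `𝔥` is `2n - rk A`,
the simple roots `α_j` and simple coroots `h_i` are linearly independent, and `α_j (h_i) = a_ij`. -/
structure Realization (A : Matrix (Fin n) (Fin n) ℤ) (𝔥 : Type u) [AddCommGroup 𝔥]
    [Module ℂ 𝔥] where
  root : Fin n → Module.Dual ℂ 𝔥
  coroot : Fin n → 𝔥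
  finite : Module.Finite ℂ 𝔥
  finrank_add_rank : Module.finrank ℂ 𝔥 + (A.map (Int.cast : ℤ → ℂ)).rank = 2 * n
  linearIndependent_root : LinearIndependent ℂ root
  linearIndependent_coroot : LinearIndependent ℂ coroot
  root_coroot : ∀ i j, root j (coroot i) = (A i j : ℂ)

/-- Generators of the Kac-Moody algebra: the elements of `𝔥` and the Chevalley generators. -/
inductive Gen (n : ℕ) (𝔥 : Type u) : Type u
  | h : 𝔥 → Gen n 𝔥
  | e : Fin n → Gen n 𝔥
  | f : Fin n → Gen n 𝔥

section Presentation

variable {A : Matrix (Fin n) (Fin n) ℤ} {𝔥 : Type u} [AddCommGroup 𝔥] [Module ℂ 𝔥]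

/-- The free complex Lie algebra on the generators. -/
abbrev FreeGen (n : ℕ) (𝔥 : Type u) : Type u := FreeLieAlgebra ℂ (Gen n 𝔥)

/-- The generator attached to `x ∈ 𝔥`. -/
def FreeGen.H (n : ℕ) (x : 𝔥) : FreeGen n 𝔥 := FreeLieAlgebra.of ℂ (Gen.h x)

/-- The generator `e_i`. -/
def FreeGen.E (𝔥 : Type u) (i : Fin n) : FreeGen n 𝔥 := FreeLieAlgebra.of ℂ (Gen.e i)

/-- The generator `f_i`. -/
def FreeGen.F (𝔥 : Type u) (i : Fin n) : FreeGen n 𝔥 := FreeLieAlgebra.of ℂ (Gen.f i)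

open FreeGen

/-- `IsRelator R x` says that `x = 0` is one of the defining relations of the Kac-Moody algebra
attached to the realization `R`. The first two families of relations express that `𝔥` maps
linearly to the algebra. -/
inductive IsRelator (R : Realization A 𝔥) : FreeGen n 𝔥 → Prop
  | h_add (x y : 𝔥) : IsRelator R (H n (x + y) - (H n x + H n y))
  | h_smul (c : ℂ) (x : 𝔥) : IsRelator R (H n (c • x) - c • H n x)
  | hh (x y : 𝔥) : IsRelator R ⁅H n x, H n y⁆
  | he (x : 𝔥) (j : Fin n) : IsRelator R (⁅H n x, E 𝔥 j⁆ - R.root j x • E 𝔥 j)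
  | hf (x : 𝔥) (j : Fin n) : IsRelator R (⁅H n x, F 𝔥 j⁆ + R.root j x • F 𝔥 j)
  | ef_same (i : Fin n) : IsRelator R (⁅E 𝔥 i, F 𝔥 i⁆ - H n (R.coroot i))
  | ef_ne (i j : Fin n) (hij : i ≠ j) : IsRelator R ⁅E 𝔥 i, F 𝔥 j⁆
  | serre_e (i j : Fin n) (hij : i ≠ j) :
      IsRelator R ((LieAlgebra.ad ℂ (FreeGen n 𝔥) (E 𝔥 i) ^ (1 - A i j).toNat) (E 𝔥 j))
  | serre_f (i j : Fin n) (hij : i ≠ j) :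
      IsRelator R ((LieAlgebra.ad ℂ (FreeGen n 𝔥) (F 𝔥 i) ^ (1 - A i j).toNat) (F 𝔥 j))

/-- The ideal generated by the defining relations. -/
def relIdeal (R : Realization A 𝔥) : LieIdeal ℂ (FreeGen n 𝔥) :=
  LieSubmodule.lieSpan ℂ (FreeGen n 𝔥) {x | IsRelator R x}

/-- The Kac-Moody algebra `𝔤(A)` attached to a realization of `A`. -/
abbrev KMAlgebra (R : Realization A 𝔥) : Type u := FreeGen n 𝔥 ⧸ relIdeal R

/-- The quotient homomorphism onto the Kac-Moody algebra. -/
def proj (R : Realization A 𝔥) : FreeGen n 𝔥 →ₗ⁅ℂ⁆ KMAlgebra R where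
  toLinearMap := (LieSubmodule.Quotient.mk' (relIdeal R)).toLinearMap
  map_lie' := fun {x y} => LieSubmodule.Quotient.mk_bracket (I := relIdeal R) x y

/-- The image of `x ∈ 𝔥` in the Kac-Moody algebra. -/
def hh (R : Realization A 𝔥) (x : 𝔥) : KMAlgebra R := proj R (H n x)

/-- The Chevalley generator `e_i`. -/
def e (R : Realization A 𝔥) (i : Fin n) : KMAlgebra R := proj R (E 𝔥 i)

/-- The Chevalley generator `f_i`. -/
def f (R : Realization A 𝔥) (i : Fin n) : KMAlgebra R := proj R (F 𝔥 i)

theorem proj_eq_zero_iff (R : Realization A 𝔥) (x : FreeGen n 𝔥) :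
    proj R x = 0 ↔ x ∈ relIdeal R :=
  LieSubmodule.Quotient.mk_eq_zero (relIdeal R)

theorem proj_surjective (R : Realization A 𝔥) : Function.Surjective (proj R) :=
  LieSubmodule.Quotient.surjective_mk' (relIdeal R)

theorem proj_relator (R : Realization A 𝔥) {x : FreeGen n 𝔥} (hx : IsRelator R x) :
    proj R x = 0 :=
  (proj_eq_zero_iff R x).2 (LieSubmodule.subset_lieSpan hx)

theorem map_ad_pow {L L' : Type*} [LieRing L] [LieAlgebra ℂ L] [LieRing L'] [LieAlgebra ℂ L']
    (φ : L →ₗ⁅ℂ⁆ L') (x y : L) (k : ℕ) :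
    φ ((LieAlgebra.ad ℂ L x ^ k) y) = (LieAlgebra.ad ℂ L' (φ x) ^ k) (φ y) := by
  induction k with
  | zero => simp
  | succ k ih => simp only [pow_succ', Module.End.mul_apply, LieAlgebra.ad_apply,
      LieHom.map_lie, ih]

theorem ad_neg_pow_neg {L : Type*} [LieRing L] [LieAlgebra ℂ L] (x y : L) (k : ℕ)
    (h : (LieAlgebra.ad ℂ L x ^ k) y = 0) :
    (LieAlgebra.ad ℂ L (-x) ^ k) (-y) = 0 := by
  have : LieAlgebra.ad ℂ L (-x) = -LieAlgebra.ad ℂ L x := map_neg _ _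
  rw [this, map_neg]
  rcases Nat.even_or_odd k with hk | hk
  · simp [hk.neg_pow, h]
  · simp [hk.neg_pow, h]

/-- A homomorphism from the free Lie algebra that respects the defining relations descends to the
Kac-Moody algebra. -/
def descend (R : Realization A 𝔥) {L : Type*} [LieRing L] [LieAlgebra ℂ L]
    (φ : FreeGen n 𝔥 →ₗ⁅ℂ⁆ L) (hφ : ∀ x, IsRelator R x → φ x = 0) : KMAlgebra R →ₗ⁅ℂ⁆ L :=
  have hle : relIdeal R ≤ φ.ker :=
    LieSubmodule.lieSpan_le.2 fun x hx => LieHom.mem_ker.2 (hφ x hx)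
  { toLinearMap := (relIdeal R).toSubmodule.liftQ (φ : FreeGen n 𝔥 →ₗ[ℂ] L)
      fun x hx => LieHom.mem_ker.1 (hle hx)
    map_lie' := by
      intro x y
      obtain ⟨a, rfl⟩ := proj_surjective R x
      obtain ⟨b, rfl⟩ := proj_surjective R y
      exact LieHom.map_lie φ a b }

@[simp]
theorem descend_proj (R : Realization A 𝔥) {L : Type*} [LieRing L] [LieAlgebra ℂ L]
    (φ : FreeGen n 𝔥 →ₗ⁅ℂ⁆ L) (hφ : ∀ x, IsRelator R x → φ x = 0) (x : FreeGen n 𝔥) :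
    descend R φ hφ (proj R x) = φ x :=
  rfl

/-- The values of the Chevalley involution on the generators: `h ↦ -h`, `e_i ↦ -f_i`,
`f_i ↦ -e_i`. -/
def chevalleyGen (R : Realization A 𝔥) : Gen n 𝔥 → KMAlgebra R
  | .h x => -hh R x
  | .e i => -f R i
  | .f i => -e R i

/-- The Chevalley involution on the free Lie algebra, with values in the Kac-Moody algebra. -/
def chevalleyFree (R : Realization A 𝔥) : FreeGen n 𝔥 →ₗ⁅ℂ⁆ KMAlgebra R :=
  FreeLieAlgebra.lift ℂ (chevalleyGen R)

@[simp]
theorem chevalleyFree_H (R : Realization A 𝔥) (x : 𝔥) : chevalleyFree R (H n x) = -hh R x :=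
  FreeLieAlgebra.lift_of_apply _ _

@[simp]
theorem chevalleyFree_E (R : Realization A 𝔥) (i : Fin n) : chevalleyFree R (E 𝔥 i) = -f R i :=
  FreeLieAlgebra.lift_of_apply _ _

@[simp]
theorem chevalleyFree_F (R : Realization A 𝔥) (i : Fin n) : chevalleyFree R (F 𝔥 i) = -e R i :=
  FreeLieAlgebra.lift_of_apply _ _

theorem chevalleyFree_relator (R : Realization A 𝔥) (x : FreeGen n 𝔥) (hx : IsRelator R x) :
    chevalleyFree R x = 0 := by
  cases hx with
  | h_add x y =>
    have h := proj_relator R (.h_add x y)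
    simp only [map_sub, map_add, chevalleyFree_H, hh] at h ⊢
    rw [sub_eq_zero] at h
    rw [h]; abel
  | h_smul c x =>
    have h := proj_relator R (.h_smul c x)
    simp only [map_sub, map_smul, chevalleyFree_H, hh] at h ⊢
    rw [sub_eq_zero] at h
    rw [h]; simp
  | hh x y =>
    have h := proj_relator R (.hh x y)
    simp only [LieHom.map_lie, chevalleyFree_H, hh, neg_lie, lie_neg, neg_neg] at h ⊢
    exact h
  | he x j =>
    have h := proj_relator R (.hf x j)
    simp only [map_sub, map_add, LieHom.map_lie, map_smul, chevalleyFree_H,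
      chevalleyFree_E, hh, f, neg_lie, lie_neg, neg_neg, smul_neg, sub_neg_eq_add] at h ⊢
    exact h
  | hf x j =>
    have h := proj_relator R (.he x j)
    simp only [map_sub, map_add, LieHom.map_lie, map_smul, chevalleyFree_H,
      chevalleyFree_F, hh, e, neg_lie, lie_neg, neg_neg, smul_neg] at h ⊢
    rw [← sub_eq_add_neg]
    exact h
  | ef_same i =>
    have h := proj_relator R (.ef_same i)
    simp only [map_sub, LieHom.map_lie, chevalleyFree_H, chevalleyFree_E,
      chevalleyFree_F, hh, e, f, neg_lie, lie_neg, neg_neg] at h ⊢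
    rw [← lie_skew, sub_eq_zero.1 h]
    abel
  | ef_ne i j hij =>
    have h := proj_relator R (.ef_ne j i hij.symm)
    simp only [LieHom.map_lie, chevalleyFree_E, chevalleyFree_F, e, f, neg_lie, lie_neg,
      neg_neg] at h ⊢
    rw [← lie_skew, h, neg_zero]
  | serre_e i j hij =>
    have h := proj_relator R (.serre_f i j hij)
    rw [map_ad_pow] at h ⊢
    rw [chevalleyFree_E, chevalleyFree_E]
    exact ad_neg_pow_neg _ _ _ h
  | serre_f i j hij =>
    have h := proj_relator R (.serre_e i j hij)
    rw [map_ad_pow] at h ⊢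
    rw [chevalleyFree_F, chevalleyFree_F]
    exact ad_neg_pow_neg _ _ _ h

/-- The Chevalley involution as an endomorphism of the Kac-Moody algebra. -/
def chevalleyHom (R : Realization A 𝔥) : KMAlgebra R →ₗ⁅ℂ⁆ KMAlgebra R :=
  descend R (chevalleyFree R) (chevalleyFree_relator R)

theorem chevalleyHom_hh (R : Realization A 𝔥) (x : 𝔥) : chevalleyHom R (hh R x) = -hh R x :=
  chevalleyFree_H R x

theorem chevalleyHom_e (R : Realization A 𝔥) (i : Fin n) : chevalleyHom R (e R i) = -f R i :=
  chevalleyFree_E R i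

theorem chevalleyHom_f (R : Realization A 𝔥) (i : Fin n) : chevalleyHom R (f R i) = -e R i :=
  chevalleyFree_F R i

theorem chevalleyHom_involutive (R : Realization A 𝔥) :
    Function.Involutive (chevalleyHom R) := by
  have key : ((chevalleyHom R).comp (chevalleyHom R)).comp (proj R) = proj R := by
    apply FreeLieAlgebra.hom_ext
    rintro (x | i | i)
    · change chevalleyHom R (chevalleyHom R (hh R x)) = hh R x
      rw [chevalleyHom_hh, map_neg, chevalleyHom_hh, neg_neg]
    · change chevalleyHom R (chevalleyHom R (e R i)) = e R i
      rw [chevalleyHom_e, map_neg, chevalleyHom_f, neg_neg]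
    · change chevalleyHom R (chevalleyHom R (f R i)) = f R i
      rw [chevalleyHom_f, map_neg, chevalleyHom_e, neg_neg]
  intro x
  obtain ⟨a, rfl⟩ := proj_surjective R x
  exact LieHom.congr_fun key a

/-- The Chevalley involution `ω` of the Kac-Moody algebra, the automorphism with
`ω(h) = -h` on `𝔥` and `ω(e_i) = -f_i`, `ω(f_i) = -e_i`. -/
def chevalleyInvolution (R : Realization A 𝔥) : KMAlgebra R ≃ₗ⁅ℂ⁆ KMAlgebra R :=
  { chevalleyHom R with
    invFun := chevalleyHom R
    left_inv := chevalleyHom_involutive R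
    right_inv := chevalleyHom_involutive R }

/-- The Lie subalgebra `𝔨(A)` of fixed points of the Chevalley involution. -/
def fixedSubalgebra (R : Realization A 𝔥) : LieSubalgebra ℂ (KMAlgebra R) where
  carrier := {x | chevalleyInvolution R x = x}
  add_mem' := fun {x y} hx hy => by
    simp only [Set.mem_ofPred_eq] at hx hy ⊢
    rw [map_add, hx, hy]
  zero_mem' := map_zero (chevalleyInvolution R)
  smul_mem' := fun c x hx => by
    simp only [Set.mem_ofPred_eq] at hx ⊢
    rw [map_smul, hx]
  lie_mem' := fun {x y} hx hy => by
    change chevalleyInvolution R x = x at hx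
    change chevalleyInvolution R y = y at hy
    change chevalleyInvolution R ⁅x, y⁆ = ⁅x, y⁆
    rw [LieEquiv.map_lie, hx, hy]

/-- The element `Y_i = e_i - f_i = e_i + ω(e_i)` of `𝔨(A)`. -/
def Y (R : Realization A 𝔥) (i : Fin n) : fixedSubalgebra R :=
  ⟨e R i - f R i, by
    change chevalleyHom R (e R i - f R i) = e R i - f R i
    rw [map_sub, chevalleyHom_e, chevalleyHom_f]
    abel⟩

end Presentation

/-- The set `ℰ_A` of the indices `j` with `a_ij` even for all `i`. -/
def evenColumns (A : Matrix (Fin n) (Fin n) ℤ) : Set (Fin n) :=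
  {j | ∀ i, A i j ≡ 0 [ZMOD 2]}

instance (A : Matrix (Fin n) (Fin n) ℤ) (j : Fin n) : Decidable (j ∈ evenColumns A) :=
  inferInstanceAs (Decidable (∀ i, A i j ≡ 0 [ZMOD 2]))

end KacMoody

section Characters

/-! The characters of a Lie algebra (that is, its one-dimensional representations) form a vector
space under the pointwise operations. -/

attribute [local instance 100] LieRing.ofAssociativeRing

namespace LieAlgebra.LieCharacter

variable {L : Type*} [LieRing L] [LieAlgebra ℂ L]

/-- A linear functional that vanishes on brackets is a character. -/
def ofLinear (φ : L →ₗ[ℂ] ℂ) (h : ∀ x y : L, φ ⁅x, y⁆ = 0) : LieCharacter ℂ L :=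
  { φ with
    map_lie' := fun {x y} => by
      rw [LieRing.of_associative_ring_bracket, mul_comm, sub_self]
      exact h x y }

instance : Add (LieCharacter ℂ L) where
  add χ ψ := ofLinear ((χ : L →ₗ[ℂ] ℂ) + (ψ : L →ₗ[ℂ] ℂ)) fun x y => by
    simp only [LinearMap.add_apply, LieHom.coe_toLinearMap, lieCharacter_apply_lie, add_zero]

instance : Neg (LieCharacter ℂ L) where
  neg χ := ofLinear (-(χ : L →ₗ[ℂ] ℂ)) fun x y => by
    simp only [LinearMap.neg_apply, LieHom.coe_toLinearMap, lieCharacter_apply_lie, neg_zero]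

instance : SMul ℂ (LieCharacter ℂ L) where
  smul c χ := ofLinear (c • (χ : L →ₗ[ℂ] ℂ)) fun x y => by
    simp only [LinearMap.smul_apply, LieHom.coe_toLinearMap, lieCharacter_apply_lie, smul_zero]

@[simp]
theorem add_apply (χ ψ : LieCharacter ℂ L) (x : L) : (χ + ψ) x = χ x + ψ x := rfl

@[simp]
theorem neg_apply (χ : LieCharacter ℂ L) (x : L) : (-χ) x = -χ x := rfl

@[simp]
theorem smul_apply (c : ℂ) (χ : LieCharacter ℂ L) (x : L) : (c • χ) x = c * χ x := rfl

instance : AddCommGroup (LieCharacter ℂ L) where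
  add_assoc χ ψ θ := LieHom.ext fun x => add_assoc (χ x) (ψ x) (θ x)
  zero_add χ := LieHom.ext fun x => zero_add (χ x)
  add_zero χ := LieHom.ext fun x => add_zero (χ x)
  add_comm χ ψ := LieHom.ext fun x => add_comm (χ x) (ψ x)
  neg_add_cancel χ := LieHom.ext fun x => neg_add_cancel (χ x)
  nsmul := nsmulRec
  zsmul := zsmulRec

instance : Module ℂ (LieCharacter ℂ L) where
  one_smul χ := LieHom.ext fun x => one_mul (χ x)
  mul_smul c d χ := LieHom.ext fun x => mul_assoc c d (χ x)
  smul_zero c := LieHom.ext fun _ => mul_zero c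
  smul_add c χ ψ := LieHom.ext fun x => mul_add c (χ x) (ψ x)
  add_smul c d χ := LieHom.ext fun x => add_mul c d (χ x)
  zero_smul χ := LieHom.ext fun x => zero_mul (χ x)

end LieAlgebra.LieCharacter

end Characters

end

/-! Write `m = -a_ij`. For the `sl₂`-triple `(e_i, h_i, f_i)` the vector `e_j` has lowest weight
`-m`, and `ad f_i` sends `(ad e_i)^(k+1) e_j` to a scalar multiple of `(ad e_i)^k e_j`. Hence `(ad
e_i)^k e_j = P_k(ad Y_i) e_j` for polynomials `P_k` given by a three-term recurrence, and the same
polynomials serve for `-f_j`. Adding the two and imposing the Serre relations gives Berman's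
relation `P_{m+1}(ad Y_i) Y_j = 0` (`bermanSeq_Y`). A character kills brackets, so it sees only the
constant term of `P_{m+1}`, which vanishes for `m` even and not for `m` odd. Thus `χ(Y_j) = 0` as
soon as some `a_ij` is odd (`character_Y_eq_zero`).

Uniqueness holds because the `Y_i` generate `𝔨(A)` (`freeToFixed_surjective`): `𝔤(A)` is spanned by
`𝔥`, the brackets of the `e_i` and their images under `ω`, and `x + ω(x)` lies in the algebra
generated by the `Y_i`, by induction on the length of a bracket.

Existence avoids a presentation of `𝔨(A)`. Without the Serre relations, the Verma module of highest
weight `0` has the words in the `f_i` as basis, and recursion on length gives a functional `φ` with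
`φ ∘ (e_i - f_i) = t_i φ` and value `1` at the empty word. The free Lie algebra on the `Y_i` then
acts on `φ` through the character with values `t_i`. If `t` vanishes off `ℰ_A`, the constant terms
make `φ` vanish on the submodule generated by the images of the Serre elements
(`wordFunctional_serreSpan`). A relation among the `Y_i` in `𝔤(A)` maps the empty word into that
submodule, so the free character is zero on it (`freeCharacter_eq_zero`) and descends to `𝔨(A)`. -/

noncomputable section

attribute [local instance 100] LieRing.ofAssociativeRing

namespace KacMoody

/-! ### Lowest weight vectors for `sl₂` and Berman's polynomials -/

section Sl2

variable {L : Type*} [LieRing L] [LieAlgebra ℂ L]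

/-- The value at `b` of the polynomial `P_k` in `ad a`, where `P_0 = 1`, `P_1 = t` and
`P_{k+2} = t P_{k+1} + (k+1)(m-k) P_k`. -/
def bermanSeq (m : ℂ) (a b : L) : ℕ → L
  | 0 => b
  | 1 => ⁅a, b⁆
  | k + 2 => ⁅a, bermanSeq m a b (k + 1)⁆ + ((k + 1 : ℂ) * (m - k)) • bermanSeq m a b k

theorem map_bermanSeq {L' : Type*} [LieRing L'] [LieAlgebra ℂ L'] (φ : L →ₗ⁅ℂ⁆ L') (m : ℂ)
    (a b : L) (k : ℕ) : φ (bermanSeq m a b k) = bermanSeq m (φ a) (φ b) k := by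
  induction k using Nat.twoStepInduction with
  | zero => rfl
  | one => simp [bermanSeq]
  | more k ih ih' => simp only [bermanSeq, map_add, map_smul, LieHom.map_lie, ih, ih']

theorem bermanSeq_add (m : ℂ) (a b c : L) (k : ℕ) :
    bermanSeq m a (b + c) k = bermanSeq m a b k + bermanSeq m a c k := by
  induction k using Nat.twoStepInduction with
  | zero => rfl
  | one => simp [bermanSeq]
  | more k ih ih' => simp only [bermanSeq, ih, ih', lie_add, smul_add]; abel

/-- The constant term of the polynomial underlying `bermanSeq`. -/
def bermanConst (m : ℂ) : ℕ → ℂ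
  | 0 => 1
  | 1 => 0
  | k + 2 => ((k + 1 : ℂ) * (m - k)) * bermanConst m k

theorem bermanConst_odd (m : ℂ) (k : ℕ) : bermanConst m (2 * k + 1) = 0 := by
  induction k with
  | zero => rfl
  | succ k ih => rw [show 2 * (k + 1) + 1 = (2 * k + 1) + 2 by ring, bermanConst, ih, mul_zero]

/-- The constant is the product of `(2l + 1)(m - 2l)` over `l < k`, and the bound on `k` keeps each
`2l` below `m`. -/
theorem bermanConst_even_ne_zero (m k : ℕ) (hk : 2 * k ≤ m + 1) :
    bermanConst m (2 * k) ≠ 0 := by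
  induction k with
  | zero => exact one_ne_zero
  | succ k ih =>
    rw [show 2 * (k + 1) = 2 * k + 2 by ring, bermanConst]
    refine mul_ne_zero (mul_ne_zero (Nat.cast_add_one_ne_zero _) ?_) (ih (by omega))
    rw [sub_ne_zero]
    exact_mod_cast (by omega : m ≠ 2 * k)

theorem character_bermanSeq (χ : LieAlgebra.LieCharacter ℂ L) (m : ℂ) (a b : L) (k : ℕ) :
    χ (bermanSeq m a b k) = bermanConst m k * χ b := by
  induction k using Nat.twoStepInduction with
  | zero => simp [bermanSeq, bermanConst]
  | one => simp [bermanSeq, bermanConst]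
  | more k ih ih' =>
    simp only [bermanSeq, bermanConst, map_add, map_smul, LieAlgebra.lieCharacter_apply_lie, ih,
      smul_eq_mul]
    ring

theorem ad_pow_eq_neg (x y : L) (k : ℕ) :
    (LieAlgebra.ad ℂ L x ^ k) y =
      (-1 : ℂ) ^ (k + 1) • (LieAlgebra.ad ℂ L (-x) ^ k) (-y) := by
  have : LieAlgebra.ad ℂ L (-x) = -LieAlgebra.ad ℂ L x := map_neg _ _
  rw [this, map_neg]
  rcases Nat.even_or_odd k with hk | hk
  · simp [hk.neg_pow, pow_succ]
  · simp [hk.neg_pow, pow_succ]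

variable {e f h x : L} {m : ℂ}

theorem lie_h_ad_pow (he : ⁅h, e⁆ = (2 : ℂ) • e) (hx : ⁅h, x⁆ = -m • x) (k : ℕ) :
    ⁅h, (LieAlgebra.ad ℂ L e ^ k) x⁆ = (2 * k - m) • (LieAlgebra.ad ℂ L e ^ k) x := by
  induction k with
  | zero => simp [hx]
  | succ k ih =>
    rw [pow_succ', Module.End.mul_apply, LieAlgebra.ad_apply, leibniz_lie, ih, he, smul_lie,
      lie_smul, ← add_smul]
    congr 1
    push_cast
    ring

/-- The standard `sl₂` computation; its coefficient is the one in the recurrence of `bermanSeq`, and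
it vanishes at `k = m`. -/
theorem lie_f_ad_pow (hef : ⁅e, f⁆ = h) (he : ⁅h, e⁆ = (2 : ℂ) • e) (hx : ⁅h, x⁆ = -m • x)
    (hf : ⁅f, x⁆ = 0) (k : ℕ) :
    ⁅f, (LieAlgebra.ad ℂ L e ^ (k + 1)) x⁆ =
      ((k + 1 : ℂ) * (m - k)) • (LieAlgebra.ad ℂ L e ^ k) x := by
  have hfe : ⁅f, e⁆ = -h := by rw [← hef, lie_skew]
  induction k with
  | zero => simp [leibniz_lie f e x, hfe, hx, hf]
  | succ k ih =>
    rw [pow_succ', Module.End.mul_apply, LieAlgebra.ad_apply, leibniz_lie, ih, hfe, neg_lie,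
      lie_h_ad_pow he hx, lie_smul, ← LieAlgebra.ad_apply ℂ L e, ← Module.End.mul_apply,
      ← pow_succ', ← neg_smul, ← add_smul]
    congr 1
    push_cast
    ring

/-- By `lie_f_ad_pow`, `ad (e - f)` takes `(ad e)^(k+1) x` to `(ad e)^(k+2) x` minus a multiple of
`(ad e)^k x`; the recurrence adds that multiple back. -/
theorem bermanSeq_sub (hef : ⁅e, f⁆ = h) (he : ⁅h, e⁆ = (2 : ℂ) • e) (hx : ⁅h, x⁆ = -m • x)
    (hf : ⁅f, x⁆ = 0) (k : ℕ) :
    bermanSeq m (e - f) x k = (LieAlgebra.ad ℂ L e ^ k) x := by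
  induction k using Nat.twoStepInduction with
  | zero => simp [bermanSeq]
  | one => simp [bermanSeq, hf]
  | more k ih ih' =>
    rw [bermanSeq, ih, ih', sub_lie, lie_f_ad_pow hef he hx hf, pow_succ' _ (k + 1),
      Module.End.mul_apply, LieAlgebra.ad_apply]
    abel

end Sl2

/-! ### Chevalley relations and Serre elements -/

variable {n : ℕ} {A : Matrix (Fin n) (Fin n) ℤ} {𝔥 : Type*} [AddCommGroup 𝔥] [Module ℂ 𝔥]

/-- The relations among `h`, `e_i`, `f_i` that hold before the Serre relations are imposed. -/
structure ChevalleyRelations (R : Realization A 𝔥) {L : Type*} [LieRing L] [LieAlgebra ℂ L]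
    (h : 𝔥 →ₗ[ℂ] L) (e f : Fin n → L) : Prop where
  lie_h_h : ∀ x y, ⁅h x, h y⁆ = 0
  lie_h_e : ∀ x j, ⁅h x, e j⁆ = R.root j x • e j
  lie_h_f : ∀ x j, ⁅h x, f j⁆ = -R.root j x • f j
  lie_e_f : ∀ i, ⁅e i, f i⁆ = h (R.coroot i)
  lie_e_f_ne : ∀ i j, i ≠ j → ⁅e i, f j⁆ = 0

namespace ChevalleyRelations

variable {R : Realization A 𝔥} {L : Type*} [LieRing L] [LieAlgebra ℂ L]
  {h : 𝔥 →ₗ[ℂ] L} {e f : Fin n → L}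

/-- The Chevalley involution at the level of relations. It transfers statements on the `e_i` to the
`-f_i`, and it fixes `e_i - f_i = (-f_i) - (-e_i)`. -/
theorem symm (C : ChevalleyRelations R h e f) :
    ChevalleyRelations R (-h) (fun i => -f i) (fun i => -e i) where
  lie_h_h x y := by simp [C.lie_h_h]
  lie_h_e x j := by simp [C.lie_h_f]
  lie_h_f x j := by simp [C.lie_h_e]
  lie_e_f i := by
    have := lie_skew (f i) (e i)
    rw [C.lie_e_f] at this
    simpa using this.symm
  lie_e_f_ne i j hij := by
    have := lie_skew (f i) (e j)
    rw [C.lie_e_f_ne j i hij.symm] at this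
    simpa using this.symm

theorem lie_f_e_ne (C : ChevalleyRelations R h e f) {i j : Fin n} (hij : i ≠ j) :
    ⁅f i, e j⁆ = 0 := by
  rw [← lie_skew, C.lie_e_f_ne j i hij.symm, neg_zero]

theorem lie_f_e (C : ChevalleyRelations R h e f) (i : Fin n) :
    ⁅f i, e i⁆ = -h (R.coroot i) := by
  rw [← lie_skew, C.lie_e_f]

theorem lie_coroot_self (C : ChevalleyRelations R h e f) (hA : IsGCM A) (i : Fin n) :
    ⁅h (R.coroot i), e i⁆ = (2 : ℂ) • e i := by
  rw [C.lie_h_e, R.root_coroot, hA.diag]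
  norm_num

theorem lie_coroot_e (C : ChevalleyRelations R h e f) (i j : Fin n) :
    ⁅h (R.coroot i), e j⁆ = -(-(A i j : ℂ)) • e j := by
  rw [C.lie_h_e, R.root_coroot, neg_neg]

theorem bermanSeq_e (C : ChevalleyRelations R h e f) (hA : IsGCM A) {i j : Fin n} (hij : i ≠ j)
    (k : ℕ) :
    bermanSeq (-(A i j : ℂ)) (e i - f i) (e j) k = (LieAlgebra.ad ℂ L (e i) ^ k) (e j) :=
  bermanSeq_sub (C.lie_e_f i) (C.lie_coroot_self hA i) (C.lie_coroot_e i j) (C.lie_f_e_ne hij) k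

theorem bermanSeq_eq (C : ChevalleyRelations R h e f) (hA : IsGCM A) {i j : Fin n} (hij : i ≠ j)
    (k : ℕ) :
    bermanSeq (-(A i j : ℂ)) (e i - f i) (e j - f j) k =
      (LieAlgebra.ad ℂ L (e i) ^ k) (e j) + (LieAlgebra.ad ℂ L (-f i) ^ k) (-f j) := by
  rw [sub_eq_add_neg (e j), bermanSeq_add, C.bermanSeq_e hA hij, ← C.symm.bermanSeq_e hA hij k]
  congr 2
  abel

/-- The element `(ad e_i)^{1-a_ij} e_j` commutes with all `f_k`. -/
theorem lie_f_serre (C : ChevalleyRelations R h e f) (hA : IsGCM A) {i j : Fin n} (hij : i ≠ j)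
    (k : Fin n) :
    ⁅f k, (LieAlgebra.ad ℂ L (e i) ^ (1 - A i j).toNat) (e j)⁆ = 0 := by
  obtain ⟨m, hm⟩ := Int.eq_ofNat_of_zero_le (neg_nonneg.2 (hA.nonpos i j hij))
  have hm' : (1 - A i j).toNat = m + 1 := by omega
  rw [hm']
  by_cases hki : k = i
  · subst hki
    -- The exponent `m + 1` is chosen so that the coefficient `(m + 1)(m - m)` is zero.
    rw [lie_f_ad_pow (C.lie_e_f k) (C.lie_coroot_self hA k) (C.lie_coroot_e k j)
      (C.lie_f_e_ne hij)]
    have : -(A k j : ℂ) = m := by exact_mod_cast hm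
    simp [this]
  have comm : ∀ (r : ℕ) (x : L), ⁅f k, (LieAlgebra.ad ℂ L (e i) ^ r) x⁆ =
      (LieAlgebra.ad ℂ L (e i) ^ r) ⁅f k, x⁆ := by
    intro r x
    induction r with
    | zero => simp
    | succ r ih =>
      simp only [pow_succ', Module.End.mul_apply, LieAlgebra.ad_apply]
      rw [leibniz_lie, C.lie_f_e_ne hki, zero_lie, zero_add, ih]
  rw [comm]
  by_cases hkj : k = j
  · subst hkj
    rw [C.lie_f_e, pow_succ, Module.End.mul_apply, LieAlgebra.ad_apply, lie_neg, lie_skew,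
      C.lie_h_e, R.root_coroot, map_smul]
    -- What remains is `(ad e_i)^m` applied to a multiple `a_ji` of `e_i`: for `m = 0` the multiple
    -- is zero since `a_ij = 0`, otherwise `[e_i, e_i] = 0`.
    rcases m with _ | m
    · have : A k i = 0 := (hA.zero_iff i k).1 (by omega)
      simp [this]
    · simp [pow_succ]
  · rw [C.lie_f_e_ne hkj, map_zero]

theorem lie_e_serre (C : ChevalleyRelations R h e f) (hA : IsGCM A) {i j : Fin n} (hij : i ≠ j)
    (k : Fin n) :
    ⁅e k, (LieAlgebra.ad ℂ L (-f i) ^ (1 - A i j).toNat) (-f j)⁆ = 0 := by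
  have h := C.symm.lie_f_serre hA hij k
  rwa [neg_lie, neg_eq_zero] at h

theorem lie_h_serre (C : ChevalleyRelations R h e f) (i j : Fin n) (x : 𝔥) (r : ℕ) :
    ∃ c : ℂ, ⁅h x, (LieAlgebra.ad ℂ L (e i) ^ r) (e j)⁆ =
      c • (LieAlgebra.ad ℂ L (e i) ^ r) (e j) := by
  induction r with
  | zero => exact ⟨_, C.lie_h_e x j⟩
  | succ r ih =>
    obtain ⟨c, hc⟩ := ih
    refine ⟨R.root i x + c, ?_⟩
    rw [pow_succ', Module.End.mul_apply, LieAlgebra.ad_apply, leibniz_lie, C.lie_h_e, hc,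
      smul_lie, lie_smul, add_smul]

theorem lie_h_serre_neg (C : ChevalleyRelations R h e f) (i j : Fin n) (x : 𝔥) (r : ℕ) :
    ∃ c : ℂ, ⁅h x, (LieAlgebra.ad ℂ L (-f i) ^ r) (-f j)⁆ =
      c • (LieAlgebra.ad ℂ L (-f i) ^ r) (-f j) := by
  obtain ⟨c, hc⟩ := C.symm.lie_h_serre i j (-x) r
  rw [LinearMap.neg_apply, map_neg, neg_neg] at hc
  exact ⟨c, hc⟩

end ChevalleyRelations

/-! ### Berman's relations in `𝔨(A)` and the constraint on characters -/

/-- The linear map from `𝔥` to the Kac-Moody algebra. -/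
def hhLinear (R : Realization A 𝔥) : 𝔥 →ₗ[ℂ] KMAlgebra R where
  toFun := hh R
  map_add' x y := by
    have h := proj_relator R (.h_add x y)
    rw [map_sub, map_add, sub_eq_zero] at h
    exact h
  map_smul' c x := by
    have h := proj_relator R (.h_smul c x)
    rw [map_sub, map_smul, sub_eq_zero] at h
    exact h

theorem chevalleyRelations (R : Realization A 𝔥) :
    ChevalleyRelations R (hhLinear R) (e R) (f R) where
  lie_h_h x y := by
    have h := proj_relator R (.hh x y)
    rw [LieHom.map_lie] at h
    exact h
  lie_h_e x j := by
    have h := proj_relator R (.he x j)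
    rw [map_sub, map_smul, LieHom.map_lie, sub_eq_zero] at h
    exact h
  lie_h_f x j := by
    have h := proj_relator R (.hf x j)
    rw [map_add, map_smul, LieHom.map_lie, add_eq_zero_iff_eq_neg, ← neg_smul] at h
    exact h
  lie_e_f i := by
    have h := proj_relator R (.ef_same i)
    rw [map_sub, LieHom.map_lie, sub_eq_zero] at h
    exact h
  lie_e_f_ne i j hij := by
    have h := proj_relator R (.ef_ne i j hij)
    rw [LieHom.map_lie] at h
    exact h

theorem serre_e (R : Realization A 𝔥) {i j : Fin n} (hij : i ≠ j) :
    (LieAlgebra.ad ℂ (KMAlgebra R) (e R i) ^ (1 - A i j).toNat) (e R j) = 0 := by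
  have h := proj_relator R (.serre_e i j hij)
  rwa [map_ad_pow] at h

theorem serre_f (R : Realization A 𝔥) {i j : Fin n} (hij : i ≠ j) :
    (LieAlgebra.ad ℂ (KMAlgebra R) (f R i) ^ (1 - A i j).toNat) (f R j) = 0 := by
  have h := proj_relator R (.serre_f i j hij)
  rwa [map_ad_pow] at h

/-- Berman's relations between the generators `Y_i` of `𝔨(A)`. -/
theorem bermanSeq_Y (R : Realization A 𝔥) (hA : IsGCM A) {i j : Fin n} (hij : i ≠ j) :
    bermanSeq (-(A i j : ℂ)) (Y R i) (Y R j) (1 - A i j).toNat = 0 := by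
  apply Subtype.val_injective
  have h := map_bermanSeq (fixedSubalgebra R).incl (-(A i j : ℂ)) (Y R i) (Y R j)
    (1 - A i j).toNat
  refine h.trans (((chevalleyRelations R).bermanSeq_eq hA hij _).trans ?_)
  rw [serre_e R hij, ad_neg_pow_neg _ _ _ (serre_f R hij), add_zero]
  rfl

theorem character_Y_eq_zero (R : Realization A 𝔥) (hA : IsGCM A)
    (χ : LieAlgebra.LieCharacter ℂ (fixedSubalgebra R)) {j : Fin n} (hj : j ∉ evenColumns A) :
    χ (Y R j) = 0 := by
  obtain ⟨i, hi⟩ := not_forall.1 hj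
  have hi : ¬ A i j % 2 = 0 := hi
  have hij : i ≠ j := by
    rintro rfl
    exact hi (by rw [hA.diag]; rfl)
  obtain ⟨m, hm⟩ := Int.eq_ofNat_of_zero_le (neg_nonneg.2 (hA.nonpos i j hij))
  have h := congrArg χ (bermanSeq_Y R hA hij)
  -- As `a_ij` is odd, the degree `1 - a_ij` is even, which is the case of nonzero constant term.
  obtain ⟨k, hk⟩ : ∃ k, (1 - A i j).toNat = 2 * k := ⟨(1 - A i j).toNat / 2, by omega⟩
  have hc : -(A i j : ℂ) = m := by exact_mod_cast hm
  rw [character_bermanSeq, map_zero, hk, hc] at h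
  exact (mul_eq_zero.1 h).resolve_left (bermanConst_even_ne_zero m k (by omega))

/-! ### Triangular decomposition and generation of `𝔨(A)` by the `Y_i` -/

theorem mem_subalgebra_of_freeLie {X : Type*} (K : LieSubalgebra ℂ (FreeLieAlgebra ℂ X))
    (hK : ∀ x, FreeLieAlgebra.of ℂ x ∈ K)
    (a : FreeLieAlgebra ℂ X) : a ∈ K := by
  -- The generators define a map into `K`; followed by the inclusion it is the identity, by the
  -- universal property.
  have key : K.incl.comp (FreeLieAlgebra.lift ℂ fun x => (⟨_, hK x⟩ : K)) = LieHom.id := by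
    apply FreeLieAlgebra.hom_ext
    intro x
    simp [FreeLieAlgebra.lift_of_apply]
  rw [← LieHom.id_apply (R := ℂ) a, ← key]
  exact Subtype.property _

theorem mem_subalgebra (R : Realization A 𝔥) (K : LieSubalgebra ℂ (KMAlgebra R))
    (hh_mem : ∀ x, hh R x ∈ K) (e_mem : ∀ i, e R i ∈ K) (f_mem : ∀ i, f R i ∈ K)
    (x : KMAlgebra R) : x ∈ K := by
  obtain ⟨a, rfl⟩ := proj_surjective R x
  refine mem_subalgebra_of_freeLie (K.comap (proj R)) ?_ a
  rintro (x | i | i)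
  exacts [hh_mem x, e_mem i, f_mem i]

/-- The elements whose `ad` preserves a given subspace. -/
def stabilizer {L : Type*} [LieRing L] [LieAlgebra ℂ L] (V : Submodule ℂ L) :
    LieSubalgebra ℂ L where
  carrier := {x | ∀ v ∈ V, ⁅x, v⁆ ∈ V}
  add_mem' hx hy v hv := by
    rw [add_lie]
    exact V.add_mem (hx v hv) (hy v hv)
  zero_mem' v _ := by simp
  smul_mem' c x hx v hv := by
    rw [smul_lie]
    exact V.smul_mem c (hx v hv)
  lie_mem' hx hy v hv := by
    rw [lie_lie]
    exact V.sub_mem (hx _ (hy v hv)) (hy _ (hx v hv))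

/-- The iterated bracket `[e_{j_1}, [e_{j_2}, …, [e_{j_r}, e_i]…]]`. -/
def eBracket (R : Realization A 𝔥) (i : Fin n) : List (Fin n) → KMAlgebra R
  | [] => e R i
  | j :: l => ⁅e R j, eBracket R i l⁆

/-- The span of the iterated brackets of at most `r` of the `e_i`. -/
def eSpan (R : Realization A 𝔥) (r : ℕ) : Submodule ℂ (KMAlgebra R) :=
  Submodule.span ℂ {x | ∃ i l, l.length < r ∧ x = eBracket R i l}

theorem eBracket_mem (R : Realization A 𝔥) (i : Fin n) {l : List (Fin n)} {r : ℕ}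
    (h : l.length < r) : eBracket R i l ∈ eSpan R r :=
  Submodule.subset_span ⟨i, l, h, rfl⟩

theorem lie_e_mem_eSpan (R : Realization A 𝔥) (j : Fin n) {r : ℕ} {x : KMAlgebra R}
    (hx : x ∈ eSpan R r ⊔ LinearMap.range (hhLinear R)) : ⁅e R j, x⁆ ∈ eSpan R (r + 1) := by
  have h : eSpan R r ⊔ LinearMap.range (hhLinear R) ≤
      (eSpan R (r + 1)).comap (LieAlgebra.ad ℂ (KMAlgebra R) (e R j)) := by
    refine sup_le (Submodule.span_le.2 ?_) ?_
    · rintro _ ⟨i, l, hl, rfl⟩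
      have : eBracket R i (j :: l) ∈ eSpan R (r + 1) := eBracket_mem R i (Nat.succ_lt_succ hl)
      exact this
    · rintro _ ⟨y, rfl⟩
      change ⁅e R j, hhLinear R y⁆ ∈ eSpan R (r + 1)
      rw [← lie_skew, (chevalleyRelations R).lie_h_e]
      exact neg_mem (Submodule.smul_mem _ _ (eBracket_mem R j (l := []) r.succ_pos))
  exact h hx

theorem lie_hh_eBracket (R : Realization A 𝔥) (x : 𝔥) (i : Fin n) (l : List (Fin n)) :
    ∃ c : ℂ, ⁅hhLinear R x, eBracket R i l⁆ = c • eBracket R i l := by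
  induction l with
  | nil => exact ⟨_, (chevalleyRelations R).lie_h_e x i⟩
  | cons j l ih =>
    obtain ⟨c, hc⟩ := ih
    refine ⟨R.root j x + c, ?_⟩
    rw [eBracket, leibniz_lie, (chevalleyRelations R).lie_h_e, hc, smul_lie, lie_smul, add_smul]

/-- Moving `f_k` inwards, each commutator with an `e_j` is zero or `-h_k`, and `h_k` acts on the
remaining bracket by a scalar. The length therefore drops, and a bracket of length one lands in `𝔥`.
-/
theorem lie_f_eBracket (R : Realization A 𝔥) (k i : Fin n) (l : List (Fin n)) :
    ⁅f R k, eBracket R i l⁆ ∈ eSpan R l.length ⊔ LinearMap.range (hhLinear R) := by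
  have C := chevalleyRelations R
  induction l with
  | nil =>
    refine Submodule.mem_sup_right ?_
    by_cases hk : k = i
    · subst hk
      exact ⟨-R.coroot k, by rw [eBracket, C.lie_f_e, map_neg]⟩
    · rw [eBracket, C.lie_f_e_ne hk]
      exact zero_mem _
  | cons j l ih =>
    refine Submodule.mem_sup_left ?_
    rw [eBracket, leibniz_lie]
    refine add_mem ?_ (lie_e_mem_eSpan R j ih)
    by_cases hk : k = j
    · subst hk
      obtain ⟨c, hc⟩ := lie_hh_eBracket R (R.coroot k) i l
      rw [C.lie_f_e, neg_lie, hc]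
      exact neg_mem (Submodule.smul_mem _ _ (eBracket_mem R i (Nat.lt_succ_self _)))
    · rw [C.lie_f_e_ne hk, zero_lie]
      exact zero_mem _

/-- The span of the iterated brackets of the `e_i`. -/
def eSpanTop (R : Realization A 𝔥) : Submodule ℂ (KMAlgebra R) :=
  Submodule.span ℂ {x | ∃ i l, x = eBracket R i l}

theorem eSpan_le (R : Realization A 𝔥) (r : ℕ) : eSpan R r ≤ eSpanTop R :=
  Submodule.span_mono fun _ ⟨i, l, _, h⟩ => ⟨i, l, h⟩

/-- The Kac-Moody algebra is the sum of `𝔥`, the span of the iterated brackets of the `e_i`, and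
the image of that span under the Chevalley involution. -/
theorem triangular_sum_eq_top (R : Realization A 𝔥) :
    LinearMap.range (hhLinear R) ⊔ (eSpanTop R ⊔
      (eSpanTop R).map (chevalleyHom R).toLinearMap) = ⊤ := by
  have C := chevalleyRelations R
  set ω : KMAlgebra R →ₗ[ℂ] KMAlgebra R := (chevalleyHom R).toLinearMap with hω
  have ωω : ∀ x, ω (ω x) = x := chevalleyHom_involutive R
  have ωlie : ∀ x y, ω ⁅x, y⁆ = ⁅ω x, ω y⁆ := LieHom.map_lie (chevalleyHom R)
  set H := LinearMap.range (hhLinear R) with hH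
  set N := eSpanTop R with hN
  set V := H ⊔ (N ⊔ N.map ω) with hV
  have HV : H ≤ V := le_sup_left
  have NV : N ≤ V := le_sup_left.trans le_sup_right
  have ωNV : N.map ω ≤ V := le_sup_right.trans le_sup_right
  have ωH : ∀ x ∈ H, ω x ∈ H := by
    rintro _ ⟨y, rfl⟩
    exact ⟨-y, by rw [map_neg]; exact (chevalleyHom_hh R y).symm⟩
  have ωV : ∀ x ∈ V, ω x ∈ V := by
    have : V ≤ V.comap ω := by
      refine sup_le (fun x hx => HV (ωH x hx)) (sup_le (fun x hx => ωNV ⟨x, hx, rfl⟩) ?_)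
      rintro _ ⟨x, hx, rfl⟩
      change ω (ω x) ∈ V
      rw [ωω]
      exact NV hx
    exact this
  have eV : ∀ i, e R i ∈ stabilizer V := by
    intro i
    suffices V ≤ V.comap (LieAlgebra.ad ℂ (KMAlgebra R) (e R i)) from this
    refine sup_le (fun x hx => NV (eSpan_le R _ (lie_e_mem_eSpan R i (r := 0)
      (Submodule.mem_sup_right hx)))) (sup_le (Submodule.span_le.2 ?_) ?_)
    · rintro _ ⟨j, l, rfl⟩
      exact NV (Submodule.subset_span ⟨j, i :: l, rfl⟩)
    · rw [Submodule.map_le_iff_le_comap]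
      refine Submodule.span_le.2 ?_
      rintro _ ⟨j, l, rfl⟩
      change ⁅e R i, ω (eBracket R j l)⁆ ∈ V
      -- The action of `e_i` on the image of `ω` is conjugate under `ω` to that of `f_i` on brackets
      -- of the `e_j`, which is already controlled.
      have h1 : e R i = -ω (f R i) := by
        rw [show ω (f R i) = -e R i from chevalleyHom_f R i, neg_neg]
      rw [h1, neg_lie, ← ωlie]
      refine neg_mem (ωV _ ?_)
      exact sup_le ((eSpan_le R _).trans NV) HV (lie_f_eBracket R i j l)
  have ωstab : ∀ x ∈ stabilizer V, ω x ∈ stabilizer V := by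
    intro x hx v hv
    rw [← ωω v, ← ωlie]
    exact ωV _ (hx _ (ωV v hv))
  have fV : ∀ i, f R i ∈ stabilizer V := by
    intro i
    have := neg_mem (ωstab _ (eV i))
    rwa [show ω (e R i) = -f R i from chevalleyHom_e R i, neg_neg] at this
  have hhV : ∀ x, hh R x ∈ stabilizer V := by
    intro x
    have key : ∀ y, V.comap (LieAlgebra.ad ℂ (KMAlgebra R) (hhLinear R y)) ≥ H ⊔ N := by
      intro y
      refine sup_le ?_ (Submodule.span_le.2 ?_)
      · rintro _ ⟨z, rfl⟩
        change ⁅hhLinear R y, hhLinear R z⁆ ∈ V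
        rw [C.lie_h_h]
        exact zero_mem _
      · rintro _ ⟨j, l, rfl⟩
        obtain ⟨c, hc⟩ := lie_hh_eBracket R y j l
        change ⁅hhLinear R y, eBracket R j l⁆ ∈ V
        rw [hc]
        exact V.smul_mem _ (NV (Submodule.subset_span ⟨j, l, rfl⟩))
    suffices V ≤ V.comap (LieAlgebra.ad ℂ (KMAlgebra R) (hhLinear R x)) from this
    refine sup_le (le_sup_left.trans (key x)) (sup_le (le_sup_right.trans (key x)) ?_)
    rintro _ ⟨z, hz, rfl⟩
    change ⁅hhLinear R x, ω z⁆ ∈ V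
    have h1 : hhLinear R x = -ω (hhLinear R x) := by
      rw [show ω (hhLinear R x) = -hhLinear R x from chevalleyHom_hh R x, neg_neg]
    rw [h1, neg_lie, ← ωlie]
    exact neg_mem (ωV _ (key x (Submodule.mem_sup_right hz)))
  have stab_top := mem_subalgebra R _ hhV eV fV
  have e_mem : ∀ i, e R i ∈ V := fun i => NV (Submodule.subset_span ⟨i, [], rfl⟩)
  -- All of `𝔤(A)` stabilizes `V`, so `V` is a subalgebra, and it contains the generators.
  let K : LieSubalgebra ℂ (KMAlgebra R) := { V with lie_mem' := fun {x y} _ hy => stab_top x y hy }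
  refine eq_top_iff.2 fun x _ => mem_subalgebra R K (fun x => HV ⟨x, rfl⟩) e_mem (fun i => ?_) x
  have := neg_mem (ωV _ (e_mem i))
  rwa [show ω (e R i) = -f R i from chevalleyHom_e R i, neg_neg] at this

/-- The homomorphism from the free Lie algebra on `n` generators onto `𝔨(A)`. -/
def freeToFixed (R : Realization A 𝔥) :
    FreeLieAlgebra ℂ (Fin n) →ₗ⁅ℂ⁆ fixedSubalgebra R :=
  FreeLieAlgebra.lift ℂ (Y R)

@[simp]
theorem freeToFixed_of (R : Realization A 𝔥) (i : Fin n) :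
    freeToFixed R (FreeLieAlgebra.of ℂ i) = Y R i :=
  FreeLieAlgebra.lift_of_apply _ _

/-- `𝔨(A)` is generated by the elements `Y_i`. -/
theorem freeToFixed_surjective (R : Realization A 𝔥) :
    Function.Surjective (freeToFixed R) := by
  set K : LieSubalgebra ℂ (KMAlgebra R) := ((fixedSubalgebra R).incl.comp (freeToFixed R)).range
    with hK
  have Y_mem : ∀ i, e R i - f R i ∈ K := fun i =>
    ⟨FreeLieAlgebra.of ℂ i, congrArg Subtype.val (freeToFixed_of R i)⟩
  set ω : KMAlgebra R →ₗ[ℂ] KMAlgebra R := (chevalleyHom R).toLinearMap with hω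
  have ωω : ∀ x, ω (ω x) = x := chevalleyHom_involutive R
  have ωlie : ∀ x y, ω ⁅x, y⁆ = ⁅ω x, ω y⁆ := LieHom.map_lie (chevalleyHom R)
  let S : Submodule ℂ (KMAlgebra R) := K.toSubmodule.comap (LinearMap.id + ω)
  have memS : ∀ x, x ∈ S ↔ x + ω x ∈ K := fun x => Iff.rfl
  have HS : LinearMap.range (hhLinear R) ≤ S := by
    rintro _ ⟨y, rfl⟩
    rw [memS, show ω (hhLinear R y) = -hhLinear R y from chevalleyHom_hh R y, add_neg_cancel]
    exact zero_mem _
  have bracketS : ∀ r i l, l.length < r → eBracket R i l ∈ S := by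
    intro r
    induction r with
    | zero => intro i l hl; omega
    | succ r ih =>
      rintro i (_ | ⟨j, l⟩) hl
      · rw [memS, eBracket, show ω (e R i) = -f R i from chevalleyHom_e R i, ← sub_eq_add_neg]
        exact Y_mem i
      · have hl' : l.length < r := Nat.lt_of_succ_lt_succ hl
        -- Use `[e_j, x] = [Y_j, x] + [f_j, x]`. The first term is in `S` because `ω` fixes `Y_j`;
        -- the second involves only shorter brackets and `𝔥`.
        have h1 : ⁅e R j - f R j, eBracket R i l⁆ ∈ S := by
          have hY : ω (e R j - f R j) = e R j - f R j := (Y R j).2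
          have h2 := K.lie_mem (Y_mem j) (ih i l hl')
          change ⁅e R j - f R j, eBracket R i l + ω (eBracket R i l)⁆ ∈ K at h2
          rw [memS, ωlie, hY, ← lie_add]
          exact h2
        have h3 : ⁅f R j, eBracket R i l⁆ ∈ S := by
          refine sup_le (Submodule.span_le.2 ?_) HS (lie_f_eBracket R j i l)
          rintro _ ⟨i', l', hl'', rfl⟩
          exact ih i' l' (hl''.trans hl')
        have := S.add_mem h1 h3
        rwa [sub_lie, sub_add_cancel] at this
  have NS : eSpanTop R ≤ S := by
    refine Submodule.span_le.2 ?_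
    rintro _ ⟨i, l, rfl⟩
    exact bracketS _ i l (Nat.lt_succ_self _)
  have ωNS : (eSpanTop R).map ω ≤ S := by
    rintro _ ⟨x, hx, rfl⟩
    rw [memS, ωω, add_comm]
    exact NS hx
  have Stop : ∀ x, x ∈ S := fun x =>
    sup_le HS (sup_le NS ωNS) (triangular_sum_eq_top R ▸ Submodule.mem_top)
  intro x
  have hx : ω x = (x : KMAlgebra R) := x.2
  -- A fixed point `x` equals `(x + ω(x)) / 2`.
  have h := K.smul_mem (1 / 2 : ℂ) ((memS x).1 (Stop x))
  rw [hx, ← two_smul ℂ, smul_smul, show (1 / 2 : ℂ) * 2 = 1 by norm_num, one_smul] at h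
  obtain ⟨a, ha⟩ := h
  exact ⟨a, Subtype.val_injective ha⟩

/-! ### The Verma module of highest weight `0` before the Serre relations -/

/-- The vector space on the words in the letters `f_i`: the underlying space of the Verma module
of highest weight `0` over the algebra without Serre relations. -/
abbrev WordSpace (n : ℕ) : Type := List (Fin n) →₀ ℂ

/-- A word as a vector. -/
abbrev word (w : List (Fin n)) : WordSpace n := Finsupp.single w 1

/-- The linear map with given values on the words. -/
abbrev ofWords {M : Type*} [AddCommGroup M] [Module ℂ M] (v : List (Fin n) → M) :
    WordSpace n →ₗ[ℂ] M := Finsupp.linearCombination ℂ v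

theorem ofWords_word {M : Type*} [AddCommGroup M] [Module ℂ M] (v : List (Fin n) → M)
    (w : List (Fin n)) : ofWords v (word w) = v w := by
  rw [ofWords, word, Finsupp.linearCombination_single, one_smul]

theorem ext_words {M : Type*} [AddCommGroup M] [Module ℂ M] {φ ψ : WordSpace n →ₗ[ℂ] M}
    (h : ∀ w, φ (word w) = ψ (word w)) : φ = ψ :=
  Finsupp.lhom_ext' fun w => LinearMap.ext_ring (h w)

/-- The action of `f_i` on words. -/
def wordF (i : Fin n) : Module.End ℂ (WordSpace n) := ofWords fun w => word (i :: w)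

/-- The weight of a word at `x`. -/
def wordWeight (R : Realization A 𝔥) (x : 𝔥) (w : List (Fin n)) : ℂ :=
  -(w.map fun i => R.root i x).sum

/-- The action of `𝔥` on words. -/
def wordH (R : Realization A 𝔥) : 𝔥 →ₗ[ℂ] Module.End ℂ (WordSpace n) where
  toFun x := ofWords fun w => wordWeight R x w • word w
  map_add' x y := ext_words fun w => by
    rw [LinearMap.add_apply, ofWords_word, ofWords_word, ofWords_word, ← add_smul]
    congr 1
    simp only [wordWeight, map_add, List.sum_map_add]
    ring
  map_smul' c x := ext_words fun w => by
    rw [LinearMap.smul_apply, ofWords_word, ofWords_word, RingHom.id_apply, smul_smul]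
    congr 1
    simp only [wordWeight, map_smul, smul_eq_mul, List.sum_map_mul_left]
    ring

/-- The value of `e_k` on a word. -/
def wordEAux (R : Realization A 𝔥) (k : Fin n) : List (Fin n) → WordSpace n
  | [] => 0
  | i :: w => wordF i (wordEAux R k w) + if k = i then wordH R (R.coroot k) (word w) else 0

/-- The action of `e_k` on words. -/
def wordE (R : Realization A 𝔥) (k : Fin n) : Module.End ℂ (WordSpace n) :=
  ofWords (wordEAux R k)

theorem wordF_word (i : Fin n) (w : List (Fin n)) : wordF i (word w) = word (i :: w) :=
  ofWords_word _ _

theorem wordH_word (R : Realization A 𝔥) (x : 𝔥) (w : List (Fin n)) :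
    wordH R x (word w) = wordWeight R x w • word w :=
  ofWords_word _ _

theorem wordE_nil (R : Realization A 𝔥) (k : Fin n) : wordE R k (word []) = 0 :=
  ofWords_word _ _

theorem wordE_wordF (R : Realization A 𝔥) (k i : Fin n) (v : WordSpace n) :
    wordE R k (wordF i v) =
      wordF i (wordE R k v) + if k = i then wordH R (R.coroot k) v else 0 := by
  have : wordE R k ∘ₗ wordF i =
      wordF i ∘ₗ wordE R k + if k = i then wordH R (R.coroot k) else 0 := by
    apply ext_words
    intro w
    rw [LinearMap.comp_apply, wordF_word, LinearMap.add_apply, LinearMap.comp_apply, wordE,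
      ofWords_word, ofWords_word, wordEAux]
    split_ifs <;> rfl
  refine (LinearMap.congr_fun this v).trans ?_
  rw [LinearMap.add_apply, LinearMap.comp_apply]
  split_ifs <;> rfl

theorem wordH_wordF (R : Realization A 𝔥) (x : 𝔥) (i : Fin n) (v : WordSpace n) :
    wordH R x (wordF i v) = wordF i (wordH R x v) - R.root i x • wordF i v := by
  have : wordH R x ∘ₗ wordF i = wordF i ∘ₗ wordH R x - R.root i x • wordF i := by
    apply ext_words
    intro w
    rw [LinearMap.comp_apply, wordF_word, wordH_word, LinearMap.sub_apply, LinearMap.comp_apply,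
      wordH_word, map_smul, LinearMap.smul_apply, wordF_word, ← sub_smul]
    congr 1
    simp only [wordWeight, List.map_cons, List.sum_cons]
    ring
  exact LinearMap.congr_fun this v

theorem wordH_wordH (R : Realization A 𝔥) (x y : 𝔥) (v : WordSpace n) :
    wordH R x (wordH R y v) = wordH R y (wordH R x v) := by
  have : wordH R x ∘ₗ wordH R y = wordH R y ∘ₗ wordH R x := by
    apply ext_words
    intro w
    simp only [LinearMap.comp_apply, wordH_word, map_smul]
    rw [smul_comm]
  exact LinearMap.congr_fun this v

theorem wordH_wordE (R : Realization A 𝔥) (x : 𝔥) (k : Fin n) (v : WordSpace n) :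
    wordH R x (wordE R k v) = wordE R k (wordH R x v) + R.root k x • wordE R k v := by
  have : wordH R x ∘ₗ wordE R k = wordE R k ∘ₗ wordH R x + R.root k x • wordE R k := by
    apply ext_words
    intro w
    simp only [LinearMap.comp_apply, LinearMap.add_apply, LinearMap.smul_apply]
    induction w with
    | nil => simp only [wordH_word, map_smul, wordE_nil, map_zero, smul_zero, add_zero]
    | cons i w ih =>
      rw [← wordF_word, wordE_wordF, map_add, wordH_wordF, ih, wordH_wordF, map_sub, map_smul,
        wordE_wordF, wordE_wordF, map_add, map_smul]
      by_cases h : k = i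
      · subst h
        simp only [if_true]
        rw [wordH_wordH R x]
        module
      · simp only [if_neg h, map_zero]
        module
  exact LinearMap.congr_fun this v

theorem wordRelations (R : Realization A 𝔥) :
    ChevalleyRelations R (wordH R) (wordE R) wordF where
  lie_h_h x y := LinearMap.ext fun v => by
    rw [LieRing.of_associative_ring_bracket, LinearMap.sub_apply, Module.End.mul_apply,
      Module.End.mul_apply, wordH_wordH, sub_self, LinearMap.zero_apply]
  lie_h_e x j := LinearMap.ext fun v => by
    rw [LieRing.of_associative_ring_bracket, LinearMap.sub_apply, Module.End.mul_apply,
      Module.End.mul_apply, wordH_wordE, add_sub_cancel_left, LinearMap.smul_apply]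
  lie_h_f x j := LinearMap.ext fun v => by
    rw [LieRing.of_associative_ring_bracket, LinearMap.sub_apply, Module.End.mul_apply,
      Module.End.mul_apply, wordH_wordF, LinearMap.smul_apply]
    module
  lie_e_f i := LinearMap.ext fun v => by
    rw [LieRing.of_associative_ring_bracket, LinearMap.sub_apply, Module.End.mul_apply,
      Module.End.mul_apply, wordE_wordF, if_pos rfl, add_sub_cancel_left]
  lie_e_f_ne i j hij := LinearMap.ext fun v => by
    rw [LieRing.of_associative_ring_bracket, LinearMap.sub_apply, Module.End.mul_apply,
      Module.End.mul_apply, wordE_wordF, if_neg hij, add_zero, sub_self, LinearMap.zero_apply]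

/-- The element `(ad e_i)^{1-a_ij} e_j` acts by zero. -/
theorem serre_wordE (R : Realization A 𝔥) (hA : IsGCM A) {i j : Fin n} (hij : i ≠ j) :
    (LieAlgebra.ad ℂ (Module.End ℂ (WordSpace n)) (wordE R i) ^ (1 - A i j).toNat) (wordE R j) =
      0 := by
  -- The empty word is killed by every `e_k`, hence by the Serre element. Since that element
  -- commutes with all `f_k`, the vanishing spreads to every word.
  have nil : ∀ r, (LieAlgebra.ad ℂ (Module.End ℂ (WordSpace n)) (wordE R i) ^ r) (wordE R j)
      (word []) = 0 := by
    intro r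
    induction r with
    | zero => exact wordE_nil R j
    | succ r ih =>
      rw [pow_succ', Module.End.mul_apply, LieAlgebra.ad_apply,
        LieRing.of_associative_ring_bracket, LinearMap.sub_apply, Module.End.mul_apply,
        Module.End.mul_apply, ih, wordE_nil, map_zero, map_zero, sub_self]
  refine ext_words fun w => ?_
  induction w with
  | nil => exact nil _
  | cons k w ih =>
    have h := (wordRelations R).lie_f_serre hA hij k
    rw [LieRing.of_associative_ring_bracket, sub_eq_zero] at h
    have h' := LinearMap.congr_fun h (word w)
    rw [Module.End.mul_apply, Module.End.mul_apply, ih, wordF_word] at h'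
    rw [← h', LinearMap.zero_apply, map_zero, LinearMap.zero_apply]

/-! ### The eigenfunctional of the operators `e_i - f_i` -/

/-- Approximations to the functional `φ` with `φ ∘ (e_i - f_i) = t_i φ`. -/
def wordFunctionalAux (R : Realization A 𝔥) (t : Fin n → ℂ) : ℕ → WordSpace n →ₗ[ℂ] ℂ
  | 0 => 0
  | r + 1 => ofWords fun
    | [] => 1
    | i :: w => wordFunctionalAux R t r (wordEAux R i w) - t i * wordFunctionalAux R t r (word w)

/-- The span of the words of length less than `r`. -/
def shortWords (n r : ℕ) : Submodule ℂ (WordSpace n) :=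
  Submodule.span ℂ {v | ∃ w : List (Fin n), w.length < r ∧ v = word w}

theorem word_mem_shortWords {w : List (Fin n)} {r : ℕ} (h : w.length < r) :
    word w ∈ shortWords n r :=
  Submodule.subset_span ⟨w, h, rfl⟩

theorem wordEAux_mem_shortWords (R : Realization A 𝔥) (k : Fin n) (w : List (Fin n)) :
    wordEAux R k w ∈ shortWords n w.length := by
  induction w with
  | nil => exact zero_mem _
  | cons i w ih =>
    refine add_mem ?_ ?_
    · have : shortWords n w.length ≤ (shortWords n (w.length + 1)).comap (wordF i) := by
        refine Submodule.span_le.2 ?_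
        rintro _ ⟨u, hu, rfl⟩
        change wordF i (word u) ∈ shortWords n (w.length + 1)
        rw [wordF_word]
        exact word_mem_shortWords (Nat.succ_lt_succ hu)
      exact this ih
    · split_ifs
      · rw [wordH_word]
        exact Submodule.smul_mem _ _ (word_mem_shortWords (Nat.lt_succ_self _))
      · exact zero_mem _

/-- The recursion at a word of length `l` only consults words of length less than `l`, so stage `r`
is already final on words shorter than `r`. -/
theorem wordFunctionalAux_succ (R : Realization A 𝔥) (t : Fin n → ℂ) (r : ℕ) :
    ∀ v ∈ shortWords n r, wordFunctionalAux R t (r + 1) v = wordFunctionalAux R t r v := by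
  induction r with
  | zero =>
    have : shortWords n 0 ≤ ⊥ := by
      refine Submodule.span_le.2 ?_
      rintro _ ⟨w, hw, rfl⟩
      exact absurd hw (Nat.not_lt_zero _)
    intro v hv
    rw [(Submodule.mem_bot ℂ).1 (this hv), map_zero, map_zero]
  | succ r ih =>
    suffices shortWords n (r + 1) ≤
        LinearMap.eqLocus (wordFunctionalAux R t (r + 2)) (wordFunctionalAux R t (r + 1)) from this
    refine Submodule.span_le.2 ?_
    rintro _ ⟨w, hw, rfl⟩
    change wordFunctionalAux R t (r + 2) (word w) = wordFunctionalAux R t (r + 1) (word w)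
    rw [wordFunctionalAux, ofWords_word]
    conv_rhs => rw [wordFunctionalAux, ofWords_word]
    rcases w with _ | ⟨i, w⟩
    · rfl
    · have hw : w.length < r := Nat.lt_of_succ_lt_succ hw
      have hle : shortWords n w.length ≤ shortWords n r :=
        Submodule.span_mono fun _ ⟨u, hu, h⟩ => ⟨u, hu.trans hw, h⟩
      simp only
      rw [ih _ (hle (wordEAux_mem_shortWords R i w)), ih _ (word_mem_shortWords hw)]

/-- The functional `φ` with `φ ∘ (e_i - f_i) = t_i φ` that takes the value `1` at the empty
word. -/
def wordFunctional (R : Realization A 𝔥) (t : Fin n → ℂ) : WordSpace n →ₗ[ℂ] ℂ :=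
  ofWords fun w => wordFunctionalAux R t (w.length + 1) (word w)

theorem wordFunctional_eq_aux (R : Realization A 𝔥) (t : Fin n → ℂ) (r : ℕ) :
    ∀ v ∈ shortWords n r, wordFunctional R t v = wordFunctionalAux R t r v := by
  suffices shortWords n r ≤ LinearMap.eqLocus (wordFunctional R t) (wordFunctionalAux R t r)
    from this
  refine Submodule.span_le.2 ?_
  rintro _ ⟨w, hw, rfl⟩
  change wordFunctional R t (word w) = wordFunctionalAux R t r (word w)
  rw [wordFunctional, ofWords_word]
  induction r, Nat.succ_le_of_lt hw using Nat.le_induction with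
  | base => rfl
  | succ r hr ih => rw [ih hr, wordFunctionalAux_succ R t r _ (word_mem_shortWords hr)]

theorem wordFunctional_nil (R : Realization A 𝔥) (t : Fin n → ℂ) :
    wordFunctional R t (word []) = 1 := by
  rw [wordFunctional, ofWords_word, wordFunctionalAux, ofWords_word]

theorem wordFunctional_wordF (R : Realization A 𝔥) (t : Fin n → ℂ) (i : Fin n)
    (v : WordSpace n) :
    wordFunctional R t (wordF i v) =
      wordFunctional R t (wordE R i v) - t i * wordFunctional R t v := by
  have : wordFunctional R t ∘ₗ wordF i =
      wordFunctional R t ∘ₗ wordE R i - t i • wordFunctional R t := by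
    refine ext_words fun w => ?_
    rw [LinearMap.comp_apply, wordF_word, LinearMap.sub_apply, LinearMap.comp_apply,
      LinearMap.smul_apply, wordE, ofWords_word,
      -- Stage `w.length + 2` at `i :: w` unfolds to stage `w.length + 1`, so the value at `e_i w`
      -- is raised by one stage to match.
      wordFunctional_eq_aux R t (w.length + 2) _ (word_mem_shortWords (Nat.lt_succ_self _)),
      wordFunctional_eq_aux R t (w.length + 1) _ (word_mem_shortWords (Nat.lt_succ_self _)),
      wordFunctional_eq_aux R t w.length _ (wordEAux_mem_shortWords R i w),
      ← wordFunctionalAux_succ R t w.length _ (wordEAux_mem_shortWords R i w),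
      wordFunctionalAux, ofWords_word, smul_eq_mul]
  exact LinearMap.congr_fun this v

/-- The character of the free Lie algebra with given values on the generators. -/
def freeCharacter (t : Fin n → ℂ) : LieAlgebra.LieCharacter ℂ (FreeLieAlgebra ℂ (Fin n)) :=
  FreeLieAlgebra.lift ℂ t

theorem freeCharacter_of (t : Fin n → ℂ) (i : Fin n) :
    freeCharacter t (FreeLieAlgebra.of ℂ i) = t i :=
  FreeLieAlgebra.lift_of_apply _ _

/-- The operators through which the free Lie algebra acts on words, its generators acting by
`e_i - f_i`. -/
def freeToWord (R : Realization A 𝔥) :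
    FreeLieAlgebra ℂ (Fin n) →ₗ⁅ℂ⁆ Module.End ℂ (WordSpace n) :=
  FreeLieAlgebra.lift ℂ fun i => wordE R i - wordF i

theorem freeToWord_of (R : Realization A 𝔥) (i : Fin n) :
    freeToWord R (FreeLieAlgebra.of ℂ i) = wordE R i - wordF i :=
  FreeLieAlgebra.lift_of_apply _ _

/-- `φ` is a common eigenvector of the transposes of the generators. The elements acting on it by
the scalar `freeCharacter t` form a subalgebra, since commuting scalars kill brackets. -/
theorem wordFunctional_freeToWord (R : Realization A 𝔥) (t : Fin n → ℂ)
    (a : FreeLieAlgebra ℂ (Fin n)) (v : WordSpace n) :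
    wordFunctional R t (freeToWord R a v) = freeCharacter t a * wordFunctional R t v := by
  let K : LieSubalgebra ℂ (FreeLieAlgebra ℂ (Fin n)) :=
    { carrier := {a | ∀ v, wordFunctional R t (freeToWord R a v) =
        freeCharacter t a * wordFunctional R t v}
      add_mem' := fun {a b} ha hb v => by
        rw [map_add, map_add, LinearMap.add_apply, map_add, ha v, hb v, add_mul]
      zero_mem' := fun v => by
        rw [map_zero, map_zero, LinearMap.zero_apply, map_zero, zero_mul]
      smul_mem' := fun c a ha v => by
        rw [map_smul, map_smul, LinearMap.smul_apply, map_smul, ha v, smul_eq_mul, smul_eq_mul,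
          mul_assoc]
      lie_mem' := fun {a b} ha hb v => by
        rw [LieAlgebra.lieCharacter_apply_lie, LieHom.map_lie,
          LieRing.of_associative_ring_bracket, LinearMap.sub_apply, map_sub,
          Module.End.mul_apply, Module.End.mul_apply, ha, hb, hb, ha]
        ring }
  refine mem_subalgebra_of_freeLie K (fun i v => ?_) a v
  rw [freeToWord_of, freeCharacter_of, LinearMap.sub_apply, map_sub, wordFunctional_wordF]
  ring

/-! ### The submodule generated by the Serre elements -/

/-- The element `(ad f_i)^{1-a_ij} f_j` as an operator on words, up to sign. -/
def serreF (A : Matrix (Fin n) (Fin n) ℤ) (i j : Fin n) : Module.End ℂ (WordSpace n) :=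
  (LieAlgebra.ad ℂ (Module.End ℂ (WordSpace n)) (-wordF i) ^ (1 - A i j).toNat) (-wordF j)

/-- The half of Berman's expression in the `e_i` acts by zero, so `serreF` is the action of an
element of the free Lie algebra on the `Y_i`, and `φ` turns it into the constant term times `t_j`.
Either `t_j = 0`, or `1 - a_ij` is odd and the constant term is zero. -/
theorem wordFunctional_serreF (R : Realization A 𝔥) (hA : IsGCM A) {t : Fin n → ℂ}
    (ht : ∀ j, j ∉ evenColumns A → t j = 0) {i j : Fin n} (hij : i ≠ j) (v : WordSpace n) :
    wordFunctional R t (serreF A i j v) = 0 := by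
  have h := (wordRelations R).bermanSeq_eq hA hij (1 - A i j).toNat
  rw [serre_wordE R hA hij, zero_add, ← freeToWord_of, ← freeToWord_of, ← map_bermanSeq] at h
  rw [serreF, ← h, wordFunctional_freeToWord, character_bermanSeq, freeCharacter_of]
  by_cases hj : j ∈ evenColumns A
  · have h0 := hA.nonpos i j hij
    have h2 : A i j % 2 = 0 := hj i
    rw [show (1 - A i j).toNat = 2 * ((1 - A i j).toNat / 2) + 1 by omega, bermanConst_odd,
      zero_mul, zero_mul]
  · rw [ht j hj, mul_zero, zero_mul]

/-- The span of the vectors obtained by applying at most `r` of the `f_k` to the image of a Serre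
element. -/
def serreSpan (A : Matrix (Fin n) (Fin n) ℤ) : ℕ → Submodule ℂ (WordSpace n)
  | 0 => Submodule.span ℂ {v | ∃ i j, i ≠ j ∧ ∃ w, v = serreF A i j w}
  | r + 1 => serreSpan A r ⊔ Submodule.span ℂ {v | ∃ i, ∃ w ∈ serreSpan A r, v = wordF i w}

theorem wordF_mem_serreSpan (i : Fin n) {r : ℕ} {v : WordSpace n} (hv : v ∈ serreSpan A r) :
    wordF i v ∈ serreSpan A (r + 1) :=
  Submodule.mem_sup_right (Submodule.subset_span ⟨i, v, hv, rfl⟩)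

theorem serreSpan_mono : Monotone (serreSpan A) :=
  monotone_nat_of_le_succ fun _ => le_sup_left

theorem wordH_mem_serreSpan (R : Realization A 𝔥) (x : 𝔥) (r : ℕ) :
    ∀ v ∈ serreSpan A r, wordH R x v ∈ serreSpan A r := by
  induction r with
  | zero =>
    suffices serreSpan A 0 ≤ (serreSpan A 0).comap (wordH R x) from this
    refine Submodule.span_le.2 ?_
    rintro _ ⟨i, j, hij, w, rfl⟩
    change wordH R x (serreF A i j w) ∈ serreSpan A 0
    obtain ⟨c, hc⟩ := (wordRelations R).lie_h_serre_neg i j x (1 - A i j).toNat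
    have h : wordH R x (serreF A i j w) - serreF A i j (wordH R x w) = c • serreF A i j w :=
      LinearMap.congr_fun hc w
    rw [sub_eq_iff_eq_add] at h
    rw [h]
    exact add_mem (Submodule.smul_mem _ _ (Submodule.subset_span ⟨i, j, hij, w, rfl⟩))
      (Submodule.subset_span ⟨i, j, hij, wordH R x w, rfl⟩)
  | succ r ih =>
    suffices serreSpan A (r + 1) ≤ (serreSpan A (r + 1)).comap (wordH R x) from this
    refine sup_le (fun v hv => serreSpan_mono r.le_succ (ih v hv)) (Submodule.span_le.2 ?_)
    rintro _ ⟨i, w, hw, rfl⟩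
    change wordH R x (wordF i w) ∈ serreSpan A (r + 1)
    rw [wordH_wordF]
    exact sub_mem (wordF_mem_serreSpan i (ih w hw))
      (Submodule.smul_mem _ _ (wordF_mem_serreSpan i hw))

/-- `e_k` commutes with the Serre operators, and `[e_k, f_i]` lies in `𝔥`, which preserves each
level. That `e_k` does not raise the level is what the induction in `wordFunctional_serreSpan`
needs. -/
theorem wordE_mem_serreSpan (R : Realization A 𝔥) (hA : IsGCM A) (k : Fin n) (r : ℕ) :
    ∀ v ∈ serreSpan A r, wordE R k v ∈ serreSpan A r := by
  induction r with
  | zero =>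
    suffices serreSpan A 0 ≤ (serreSpan A 0).comap (wordE R k) from this
    refine Submodule.span_le.2 ?_
    rintro _ ⟨i, j, hij, w, rfl⟩
    change wordE R k (serreF A i j w) ∈ serreSpan A 0
    have h := (wordRelations R).lie_e_serre hA hij k
    rw [LieRing.of_associative_ring_bracket, sub_eq_zero] at h
    exact Submodule.subset_span ⟨i, j, hij, wordE R k w, LinearMap.congr_fun h w⟩
  | succ r ih =>
    suffices serreSpan A (r + 1) ≤ (serreSpan A (r + 1)).comap (wordE R k) from this
    refine sup_le (fun v hv => serreSpan_mono r.le_succ (ih v hv)) (Submodule.span_le.2 ?_)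
    rintro _ ⟨i, w, hw, rfl⟩
    change wordE R k (wordF i w) ∈ serreSpan A (r + 1)
    rw [wordE_wordF]
    refine add_mem (wordF_mem_serreSpan i (ih w hw)) ?_
    split_ifs
    · exact serreSpan_mono r.le_succ (wordH_mem_serreSpan R _ r w hw)
    · exact zero_mem _

theorem wordFunctional_serreSpan (R : Realization A 𝔥) (hA : IsGCM A) {t : Fin n → ℂ}
    (ht : ∀ j, j ∉ evenColumns A → t j = 0) (r : ℕ) :
    ∀ v ∈ serreSpan A r, wordFunctional R t v = 0 := by
  induction r with
  | zero =>
    suffices serreSpan A 0 ≤ LinearMap.ker (wordFunctional R t) from this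
    refine Submodule.span_le.2 ?_
    rintro _ ⟨i, j, hij, w, rfl⟩
    exact wordFunctional_serreF R hA ht hij w
  | succ r ih =>
    suffices serreSpan A (r + 1) ≤ LinearMap.ker (wordFunctional R t) from this
    refine sup_le ih (Submodule.span_le.2 ?_)
    rintro _ ⟨i, w, hw, rfl⟩
    change wordFunctional R t (wordF i w) = 0
    -- The eigenfunctional property trades `f_i w` for `e_i w` and `w`, both of level `r`.
    rw [wordFunctional_wordF, ih w hw, ih _ (wordE_mem_serreSpan R hA i r w hw), mul_zero,
      sub_zero]

/-- The submodule generated by the images of the Serre elements. -/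
def serreSubmodule (A : Matrix (Fin n) (Fin n) ℤ) : Submodule ℂ (WordSpace n) :=
  ⨆ r, serreSpan A r

theorem mem_serreSubmodule {v : WordSpace n} :
    v ∈ serreSubmodule A ↔ ∃ r, v ∈ serreSpan A r :=
  Submodule.mem_iSup_of_directed _ serreSpan_mono.directed_le

/-! ### Passage to the relations of `𝔤(A)` -/

/-- The values on generators of the action of the free Lie algebra on words. -/
def wordRepGen (R : Realization A 𝔥) : Gen n 𝔥 → Module.End ℂ (WordSpace n)
  | .h x => wordH R x
  | .e i => wordE R i
  | .f i => wordF i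

/-- The action of the free Lie algebra on words. -/
def wordRep (R : Realization A 𝔥) : FreeGen n 𝔥 →ₗ⁅ℂ⁆ Module.End ℂ (WordSpace n) :=
  FreeLieAlgebra.lift ℂ (wordRepGen R)

theorem wordRep_H (R : Realization A 𝔥) (x : 𝔥) : wordRep R (FreeGen.H n x) = wordH R x :=
  FreeLieAlgebra.lift_of_apply _ _

theorem wordRep_E (R : Realization A 𝔥) (i : Fin n) :
    wordRep R (FreeGen.E 𝔥 i) = wordE R i :=
  FreeLieAlgebra.lift_of_apply _ _

theorem wordRep_F (R : Realization A 𝔥) (i : Fin n) : wordRep R (FreeGen.F 𝔥 i) = wordF i :=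
  FreeLieAlgebra.lift_of_apply _ _

theorem wordRep_mem_serreSubmodule (R : Realization A 𝔥) (hA : IsGCM A) (a : FreeGen n 𝔥) :
    ∀ v ∈ serreSubmodule A, wordRep R a v ∈ serreSubmodule A := by
  let K : LieSubalgebra ℂ (FreeGen n 𝔥) :=
    { carrier := {a | ∀ v ∈ serreSubmodule A, wordRep R a v ∈ serreSubmodule A}
      add_mem' := fun {a b} ha hb v hv => by
        rw [map_add]
        exact add_mem (ha v hv) (hb v hv)
      zero_mem' := fun v _ => by
        rw [map_zero]
        exact zero_mem _
      smul_mem' := fun c a ha v hv => by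
        rw [map_smul]
        exact Submodule.smul_mem _ c (ha v hv)
      lie_mem' := fun {a b} ha hb v hv => by
        rw [LieHom.map_lie, LieRing.of_associative_ring_bracket]
        exact sub_mem (ha _ (hb v hv)) (hb _ (ha v hv)) }
  refine mem_subalgebra_of_freeLie K ?_ a
  rintro (x | i | i) v hv <;> obtain ⟨r, hr⟩ := mem_serreSubmodule.1 hv
  · exact mem_serreSubmodule.2 ⟨r, wordRep_H R x ▸ wordH_mem_serreSpan R x r v hr⟩
  · exact mem_serreSubmodule.2 ⟨r, wordRep_E R i ▸ wordE_mem_serreSpan R hA i r v hr⟩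
  · exact mem_serreSubmodule.2 ⟨r + 1, wordRep_F R i ▸ wordF_mem_serreSpan i hr⟩

theorem wordRep_relator (R : Realization A 𝔥) (hA : IsGCM A) {a : FreeGen n 𝔥}
    (ha : IsRelator R a) (v : WordSpace n) : wordRep R a v ∈ serreSubmodule A := by
  have C := wordRelations R
  suffices wordRep R a = 0 ∨ ∃ i j, i ≠ j ∧ ∃ c : ℂ, wordRep R a = c • serreF A i j by
    rcases this with h | ⟨i, j, hij, c, h⟩
    · rw [h, LinearMap.zero_apply]
      exact zero_mem _
    · rw [h, LinearMap.smul_apply]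
      exact Submodule.smul_mem _ _
        (mem_serreSubmodule.2 ⟨0, Submodule.subset_span ⟨i, j, hij, v, rfl⟩⟩)
  cases ha with
  | h_add x y => left; simp only [map_sub, map_add, wordRep_H, sub_self]
  | h_smul c x => left; simp only [map_sub, map_smul, wordRep_H, sub_self]
  | hh x y => left; rw [LieHom.map_lie, wordRep_H, wordRep_H, C.lie_h_h]
  | he x j =>
    left
    rw [map_sub, map_smul, LieHom.map_lie, wordRep_H, wordRep_E, C.lie_h_e, sub_self]
  | hf x j =>
    left
    rw [map_add, map_smul, LieHom.map_lie, wordRep_H, wordRep_F, C.lie_h_f, neg_smul,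
      neg_add_cancel]
  | ef_same i =>
    left
    rw [map_sub, LieHom.map_lie, wordRep_H, wordRep_E, wordRep_F, C.lie_e_f, sub_self]
  | ef_ne i j hij => left; rw [LieHom.map_lie, wordRep_E, wordRep_F, C.lie_e_f_ne i j hij]
  | serre_e i j hij =>
    left
    rw [map_ad_pow, wordRep_E, wordRep_E, serre_wordE R hA hij]
  | serre_f i j hij =>
    right
    -- One sign for each `ad (-f_i)` and one more for `-f_j`.
    refine ⟨i, j, hij, (-1) ^ ((1 - A i j).toNat + 1), ?_⟩
    rw [map_ad_pow, wordRep_F, wordRep_F]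
    exact ad_pow_eq_neg _ _ _

/-- Because the Serre submodule is stable, the elements sending all words into it form an ideal;
this ideal contains the relators. -/
theorem wordRep_relIdeal (R : Realization A 𝔥) (hA : IsGCM A) {a : FreeGen n 𝔥}
    (ha : a ∈ relIdeal R) (v : WordSpace n) : wordRep R a v ∈ serreSubmodule A := by
  let J : LieIdeal ℂ (FreeGen n 𝔥) :=
    { carrier := {a | ∀ v, wordRep R a v ∈ serreSubmodule A}
      add_mem' := fun {a b} ha hb v => by
        rw [map_add]
        exact add_mem (ha v) (hb v)
      zero_mem' := fun v => by
        rw [map_zero]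
        exact zero_mem _
      smul_mem' := fun c a ha v => by
        rw [map_smul]
        exact Submodule.smul_mem _ c (ha v)
      lie_mem := fun {a b} hb v => by
        rw [LieHom.map_lie, LieRing.of_associative_ring_bracket]
        exact sub_mem (wordRep_mem_serreSubmodule R hA a _ (hb v)) (hb _) }
  exact (LieSubmodule.lieSpan_le.2 fun a ha => wordRep_relator R hA ha : relIdeal R ≤ J) ha v

/-- Lift `a` to the free algebra on all generators through `Y_i ↦ e_i - f_i`; the lift is in the
relation ideal, so it maps the empty word into the Serre submodule. There `φ` is zero, while by the
eigenfunctional property its value is `freeCharacter t a`. -/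
theorem freeCharacter_eq_zero (R : Realization A 𝔥) (hA : IsGCM A) {t : Fin n → ℂ}
    (ht : ∀ j, j ∉ evenColumns A → t j = 0) {a : FreeLieAlgebra ℂ (Fin n)}
    (ha : freeToFixed R a = 0) : freeCharacter t a = 0 := by
  let ι : FreeLieAlgebra ℂ (Fin n) →ₗ⁅ℂ⁆ FreeGen n 𝔥 :=
    FreeLieAlgebra.lift ℂ fun i => FreeGen.E 𝔥 i - FreeGen.F 𝔥 i
  have hι : ∀ i, ι (FreeLieAlgebra.of ℂ i) = FreeGen.E 𝔥 i - FreeGen.F 𝔥 i :=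
    fun i => FreeLieAlgebra.lift_of_apply _ _
  have h1 : (proj R).comp ι = (fixedSubalgebra R).incl.comp (freeToFixed R) := by
    apply FreeLieAlgebra.hom_ext
    intro i
    rw [LieHom.comp_apply, LieHom.comp_apply, hι, map_sub, freeToFixed_of]
    rfl
  have h2 : (wordRep R).comp ι = freeToWord R := by
    apply FreeLieAlgebra.hom_ext
    intro i
    rw [LieHom.comp_apply, hι, map_sub, wordRep_E, wordRep_F, freeToWord_of]
  have h3 : ι a ∈ relIdeal R := by
    rw [← proj_eq_zero_iff, ← LieHom.comp_apply, h1, LieHom.comp_apply, ha, map_zero]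
  have h4 := wordRep_relIdeal R hA h3 (word [])
  rw [← LieHom.comp_apply, h2] at h4
  obtain ⟨r, hr⟩ := mem_serreSubmodule.1 h4
  have h5 := wordFunctional_serreSpan R hA ht r _ hr
  rwa [wordFunctional_freeToWord, wordFunctional_nil, mul_one] at h5

/-! ### Existence and uniqueness of characters -/

theorem exists_character (R : Realization A 𝔥) (hA : IsGCM A) {t : Fin n → ℂ}
    (ht : ∀ j, j ∉ evenColumns A → t j = 0) :
    ∃ χ : LieAlgebra.LieCharacter ℂ (fixedSubalgebra R), ∀ j, χ (Y R j) = t j := by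
  -- Any linear section will do: lifts of one element differ by the kernel, where the free character
  -- is zero.
  obtain ⟨s, hs⟩ := LinearMap.exists_rightInverse_of_surjective (freeToFixed R).toLinearMap
    (LinearMap.range_eq_top.2 (freeToFixed_surjective R))
  have hs' : ∀ x, freeToFixed R (s x) = x := LinearMap.congr_fun hs
  have key : ∀ a b, freeToFixed R a = freeToFixed R b → freeCharacter t a = freeCharacter t b := by
    intro a b hab
    rw [← sub_eq_zero, ← map_sub]
    exact freeCharacter_eq_zero R hA ht (by rw [map_sub, hab, sub_self])
  refine ⟨LieAlgebra.LieCharacter.ofLinear ((freeCharacter t).toLinearMap ∘ₗ s) fun x y => ?_,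
    fun j => ?_⟩
  · refine (key (s ⁅x, y⁆) ⁅s x, s y⁆ ?_).trans (LieAlgebra.lieCharacter_apply_lie _ _ _)
    rw [hs', LieHom.map_lie, hs', hs']
  · refine (key (s (Y R j)) (FreeLieAlgebra.of ℂ j) ?_).trans (freeCharacter_of t j)
    rw [hs', freeToFixed_of]

theorem character_ext (R : Realization A 𝔥)
    {χ ψ : LieAlgebra.LieCharacter ℂ (fixedSubalgebra R)} (h : ∀ j, χ (Y R j) = ψ (Y R j)) :
    χ = ψ := by
  have key : χ.comp (freeToFixed R) = ψ.comp (freeToFixed R) := by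
    apply FreeLieAlgebra.hom_ext
    intro j
    rw [LieHom.comp_apply, LieHom.comp_apply, freeToFixed_of, h]
  refine LieHom.ext fun x => ?_
  obtain ⟨a, rfl⟩ := freeToFixed_surjective R x
  exact LieHom.congr_fun key a

/-- Evaluation of characters at the `Y_j` with `j ∈ ℰ_A`. -/
def evalCharacter (R : Realization A 𝔥) :
    LieAlgebra.LieCharacter ℂ (fixedSubalgebra R) →ₗ[ℂ] (evenColumns A → ℂ) where
  toFun χ j := χ (Y R j)
  map_add' _ _ := rfl
  map_smul' _ _ := rfl

theorem evalCharacter_bijective (R : Realization A 𝔥) (hA : IsGCM A) :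
    Function.Bijective (evalCharacter R) := by
  refine ⟨fun χ ψ h => character_ext R fun j => ?_, fun t => ?_⟩
  · by_cases hj : j ∈ evenColumns A
    · exact congrFun h ⟨j, hj⟩
    · rw [character_Y_eq_zero R hA χ hj, character_Y_eq_zero R hA ψ hj]
  · obtain ⟨χ, hχ⟩ := exists_character R hA
      (t := fun j => if hj : j ∈ evenColumns A then t ⟨j, hj⟩ else 0) fun j hj => dif_neg hj
    exact ⟨χ, funext fun j => (hχ j).trans (dif_pos j.2)⟩

end KacMoody

end

theorem proposition2p6 {n : ℕ} (A : Matrix (Fin n) (Fin n) ℤ)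
    (hA : KacMoody.IsGCM A) (hsymm : KacMoody.IsSymmetrizable A)
    {𝔥 : Type*} [AddCommGroup 𝔥] [Module ℂ 𝔥] (R : KacMoody.Realization A 𝔥) :
    ∃ χ : (KacMoody.evenColumns A → ℂ) ≃ₗ[ℂ]
        LieAlgebra.LieCharacter ℂ (KacMoody.fixedSubalgebra R),
      ∀ t : KacMoody.evenColumns A → ℂ,
        (∀ j : Fin n, χ t (KacMoody.Y R j) =
          if hj : j ∈ KacMoody.evenColumns A then t ⟨j, hj⟩ else 0) ∧
        ∀ ψ : LieAlgebra.LieCharacter ℂ (KacMoody.fixedSubalgebra R),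
          (∀ j : Fin n, ψ (KacMoody.Y R j) =
            if hj : j ∈ KacMoody.evenColumns A then t ⟨j, hj⟩ else 0) → ψ = χ t := by
  let E := LinearEquiv.ofBijective _ (KacMoody.evalCharacter_bijective R hA)
  have hE : ∀ t (j : Fin n), E.symm t (KacMoody.Y R j) =
      if hj : j ∈ KacMoody.evenColumns A then t ⟨j, hj⟩ else 0 := by
    intro t j
    split_ifs with hj
    · exact congrFun (E.apply_symm_apply t) ⟨j, hj⟩
    · exact KacMoody.character_Y_eq_zero R hA _ hj
  exact ⟨E.symm, fun t => ⟨hE t, fun ψ hψ => KacMoody.character_ext R fun j =>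
    (hψ j).trans (hE t j).symm⟩⟩
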